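/- Let $A$ be a commutative complex Banach algebra, not necessarily unital, and let $\Phi_A$ be its carrier space (the nonzero characters of $A$ with the weak* topology). Assume that $A$ is semisimple (the Gelfand transform $a\mapsto(t\mapsto a(t):=t(a))$ is injective) and regular (for every closed $F\subseteq\Phi_A$ and $t\in\Phi_A\setminus F$ there is $a\in A$ with $a(t)=1$ and $a=0$ on $F$). For an element $x$ of a Banach left $A$-module, its support is $\operatorname{supp}x=\{t\in\Phi_A: a(t)=0\text{ for all }a\in A\text{ with }ax=0\}$; a linear operator $T$ between Banach left $A$-modules is local if $\operatorname{supp}T(x)\subseteq\operatorname{supp}x$ for all $x$. Let $A^*$ carry the action $(a\cdot f)(b)=f(ba)$, and assume that $A$ is hyper-Tauberian: every bounded local operator $T\colon A\to A^*$ is a multiplier, that is, $T(ab)=a\cdot T(b)$ for all $a,b\in A$. Let $X$ be a Banach $A$-bimodule and $n\in\mathbb N$. An $n$-linear map $S\colon A^{(n)}=A\times\cdots\times A\to X$ (not necessarily bounded) is an $n$-cocycle if for all $a_1,\dots,a_{n+1}\in A$ $$a_1S(a_2,\dots,a_{n+1})+\sum_{j=1}^n(-1)^jS(a_1,\dots,a_{j-1},a_ja_{j+1},a_{j+2},\dots,a_{n+1})+(-1)^{n+1}S(a_1,\dots,a_n)a_{n+1}=0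 .$$ An $n$-linear map $T\colon A^{(n)}\to X$ is a local $n$-cocycle if for each $\tilde a\in A^{(n)}$ there is an $n$-cocycle $T_{\tilde a}\colon A^{(n)}\to X$ with $T(\tilde a)=T_{\tilde a}(\tilde a)$. Then every bounded local $n$-cocycle $T\colon A^{(n)}\to X$ is an $n$-cocycle. -/

import Mathlib

/-- A Banach left module over a Banach algebra `A`: a bounded bilinear associative action.
The carrier `X` is meant to be a Banach space. -/
structure BanachLeftModule (A X : Type*) [NonUnitalNormedRing A] [NormedSpace ℂ A]
    [NormedAddCommGroup X] [NormedSpace ℂ X] where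
  /-- `act a x` is `a · x`. -/
  act : A →L[ℂ] X →L[ℂ] X
  mul_act : ∀ (a b : A) (x : X), act (a * b) x = act a (act b x)

/-- A Banach bimodule over a Banach algebra `A`: bounded bilinear associative left and right
actions that commute. The carrier `X` is meant to be a Banach space. -/
structure BanachBimodule (A X : Type*) [NonUnitalNormedRing A] [NormedSpace ℂ A]
    [NormedAddCommGroup X] [NormedSpace ℂ X] where
  /-- `left a x` is `a · x`. -/
  left : A →L[ℂ] X →L[ℂ] X
  /-- `right a x` is `x · a`. -/
  right : A →L[ℂ] X →L[ℂ] X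
  left_mul : ∀ (a b : A) (x : X), left (a * b) x = left a (left b x)
  right_mul : ∀ (a b : A) (x : X), right (a * b) x = right b (right a x)
  left_right : ∀ (a b : A) (x : X), left a (right b x) = right b (left a x)

section HyperTauberian

variable (A : Type*)

/-- `A` as a Banach left module over itself. -/
noncomputable def BanachLeftModule.self [NonUnitalNormedRing A] [NormedSpace ℂ A]
    [IsScalarTower ℂ A A] [SMulCommClass ℂ A A] : BanachLeftModule A A where
  act := ContinuousLinearMap.mul ℂ A
  mul_act a b x := by simp [mul_assoc]

/-- The dual space `A*` as a Banach left `A`-module, with `(a · f)(b) = f (b a)`. -/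
noncomputable def BanachLeftModule.dual [NonUnitalNormedRing A] [NormedSpace ℂ A]
    [IsScalarTower ℂ A A] [SMulCommClass ℂ A A] : BanachLeftModule A (StrongDual ℂ A) where
  act := ((ContinuousLinearMap.compL ℂ A A ℂ).flip).comp (ContinuousLinearMap.mul ℂ A).flip
  mul_act a b f := by
    ext c
    simp [mul_assoc]

variable {A}

/-- The annihilator of `x` in `A`. -/
def BanachLeftModule.ann [NonUnitalNormedRing A] [NormedSpace ℂ A] {X : Type*}
    [NormedAddCommGroup X] [NormedSpace ℂ X] (M : BanachLeftModule A X) (x : X) : Set A :=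
  {a | M.act a x = 0}

/-- The hull of a subset of `A` in the carrier space `Φ_A`, which is the set
`WeakDual.characterSpace ℂ A` of nonzero continuous characters with the weak* topology. -/
def hull [NonUnitalNormedRing A] [NormedSpace ℂ A] (I : Set A) :
    Set (WeakDual.characterSpace ℂ A) :=
  {t | ∀ a ∈ I, t a = 0}

/-- The support of `x` in the carrier space: the hull of its annihilator. -/
def BanachLeftModule.supp [NonUnitalNormedRing A] [NormedSpace ℂ A] {X : Type*}
    [NormedAddCommGroup X] [NormedSpace ℂ X] (M : BanachLeftModule A X) (x : X) :
    Set (WeakDual.characterSpace ℂ A) :=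
  hull (M.ann x)

/-- Local operators between Banach left modules: those that do not enlarge supports. -/
def IsLocalOperator [NonUnitalNormedRing A] [NormedSpace ℂ A] {X Y : Type*}
    [NormedAddCommGroup X] [NormedSpace ℂ X] [NormedAddCommGroup Y] [NormedSpace ℂ Y]
    (M : BanachLeftModule A X) (N : BanachLeftModule A Y) (T : X →ₗ[ℂ] Y) : Prop :=
  ∀ x, N.supp (T x) ⊆ M.supp x

variable (A)

/-- A commutative Banach algebra is semisimple when its Gelfand transform is injective. -/
def IsSemisimpleBanachAlgebra [NonUnitalNormedCommRing A] [NormedSpace ℂ A] : Prop :=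
  ∀ a : A, (∀ t : WeakDual.characterSpace ℂ A, t a = 0) → a = 0

/-- A commutative Banach algebra is regular when Gelfand transforms separate points of the
carrier space from closed sets. -/
def IsRegularBanachAlgebra [NonUnitalNormedCommRing A] [NormedSpace ℂ A] : Prop :=
  ∀ (F : Set (WeakDual.characterSpace ℂ A)), IsClosed F → ∀ t, t ∉ F →
    ∃ a : A, t a = 1 ∧ ∀ s ∈ F, s a = 0

/-- A commutative Banach algebra `A` is hyper-Tauberian when it is semisimple and regular and
every bounded local operator from `A` into `A*` is a multiplier. -/
structure IsHyperTauberian [NonUnitalNormedCommRing A] [NormedSpace ℂ A]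
    [IsScalarTower ℂ A A] [SMulCommClass ℂ A A] : Prop where
  semisimple : IsSemisimpleBanachAlgebra A
  regular : IsRegularBanachAlgebra A
  multiplier : ∀ T : A →L[ℂ] StrongDual ℂ A,
    IsLocalOperator (BanachLeftModule.self A) (BanachLeftModule.dual A) (T : A →ₗ[ℂ] _) →
      ∀ a b : A, T (a * b) = (BanachLeftModule.dual A).act a (T b)

end HyperTauberian

section Cocycle

variable {A X : Type*} [NonUnitalNormedRing A] [NormedSpace ℂ A]
  [NormedAddCommGroup X] [NormedSpace ℂ X]

/-- The Hochschild coboundary of an `n`-linear map. With arguments numbered from `0`, the tuple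
`Fin.contractNth j.castSucc (· * ·) a` is `(a_0, …, a_j a_{j+1}, …, a_n)`. -/
noncomputable def coboundary (M : BanachBimodule A X) {n : ℕ}
    (T : MultilinearMap ℂ (fun _ : Fin n => A) X) (a : Fin (n + 1) → A) : X :=
  M.left (a 0) (T fun i => a i.succ)
    + ∑ j : Fin n, (-1 : ℂ) ^ ((j : ℕ) + 1) • T (Fin.contractNth j.castSucc (· * ·) a)
    + (-1 : ℂ) ^ (n + 1) • M.right (a (Fin.last n)) (T fun i => a i.castSucc)

/-- `n`-cocycles: `n`-linear maps, not assumed bounded, with vanishing coboundary. -/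
def IsCocycle (M : BanachBimodule A X) {n : ℕ}
    (T : MultilinearMap ℂ (fun _ : Fin n => A) X) : Prop :=
  ∀ a : Fin (n + 1) → A, coboundary M T a = 0

/-- Local `n`-cocycles: `n`-linear maps that agree at each point with some `n`-cocycle, which
may depend on the point and need not be bounded. -/
def IsLocalCocycle (M : BanachBimodule A X) {n : ℕ}
    (T : MultilinearMap ℂ (fun _ : Fin n => A) X) : Prop :=
  ∀ a : Fin n → A, ∃ S : MultilinearMap ℂ (fun _ : Fin n => A) X, IsCocycle M S ∧ T a = S a

end Cocycle

/-! Let `B` be the unitization of `A`, and extend `T` to `B` so that it vanishes whenever an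
argument is a scalar. Put G(b₀, …, bₙ, v) = b₀ · T(b₁, …, bₙ) · v. Locality of `T` makes `G` vanish
whenever all consecutive products of (b₀, …, bₙ, v) are zero
(`IsLocalCocycle.isHyperlocal_sandwich`): the cocycle agreeing with `T` at (b₁, …, bₙ) loses every
inner term of its identity there.

The hyper-Tauberian property turns vanishing at zero products into algebra. A bounded bilinear ψ on
`A` with ψ(a, b) = 0 whenever ab = 0 is balanced (`IsHyperTauberian.balanced_of_zero_product`),
whence φ(a, 1) = φ(1, a) for such maps φ on `B` and a ∈ A with a relative unit. Applied to `G` one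
variable at a time, with all later variables frozen, this yields the cocycle identity on such
elements (`ContinuousMultilinearMap.IsHyperlocal.cocycle_identity`).

Elements with a relative unit are dense (`IsHyperTauberian.dense_locallyUnital`), so continuity
finishes the proof. Density needs enough relative units in `A`; these come from a Riesz projection
in a quotient of `B`. -/

/-! ### Riesz projections -/

theorem Complex.circleIntegral_sub_inv_of_radius_lt {w : ℂ} {r : ℝ} (hr : 0 ≤ r) (hw : r < ‖w‖) :
    (∮ z in C(0, r), (z - w)⁻¹) = 0 := by
  have hne : ∀ z ∈ Metric.closedBall (0 : ℂ) r, z - w ≠ 0 := by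
    rintro z hz h
    rw [sub_eq_zero] at h
    subst h
    exact absurd (mem_closedBall_zero_iff.1 hz) (not_le.2 hw)
  refine Complex.circleIntegral_eq_zero_of_differentiable_on_off_countable hr
    Set.countable_empty ?_ ?_
  · exact ContinuousOn.inv₀ (by fun_prop) hne
  · rintro z ⟨hz, -⟩
    exact DifferentiableAt.inv (by fun_prop) (hne z (Metric.ball_subset_closedBall hz))

/-- The Riesz projection of `x` for a circle around `0` that avoids the spectrum, as seen by
characters. -/
theorem exists_riesz_projection {B : Type*} [NormedRing B] [NormedAlgebra ℂ B] [CompleteSpace B]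
    (x : B) {r : ℝ} (hr : 0 < r) (hx : ∀ z ∈ spectrum ℂ x, ‖z‖ ≠ r) :
    ∃ p : B, ∀ χ : B →ₐ[ℂ] ℂ, (‖χ x‖ < r → χ p = 1) ∧ (r < ‖χ x‖ → χ p = 0) := by
  have hcont : ContinuousOn (resolvent x : ℂ → B) (Metric.sphere 0 r) := fun z hz =>
    (spectrum.hasDerivAt_resolvent_const_left (𝕜 := ℂ) (a := x) (k := z) (by
      by_contra h
      exact hx z h (mem_sphere_zero_iff_norm.1 hz))).continuousAt.continuousWithinAt
  -- A character passes through the contour integral and sends the resolvent of `x` to the Cauchy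
  -- kernel at `χ x`.
  have key : ∀ χ : B →ₐ[ℂ] ℂ, χ ((2 * Real.pi * Complex.I : ℂ)⁻¹ • ∮ z in C(0, r), resolvent x z)
      = (2 * Real.pi * Complex.I : ℂ)⁻¹ • ∮ z in C(0, r), (z - χ x)⁻¹ := by
    intro χ
    rw [map_smul]
    congr 1
    have hint : IntervalIntegrable
        (fun θ : ℝ => deriv (circleMap 0 r) θ • resolvent x (circleMap 0 r θ))
        MeasureTheory.volume 0 (2 * Real.pi) := (hcont.circleIntegrable hr.le).out
    have := χ.toContinuousLinearMap.intervalIntegral_comp_comm hint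
    rw [circleIntegral, circleIntegral, ← AlgHom.coe_toContinuousLinearMap, ← this]
    refine intervalIntegral.integral_congr fun θ _ => ?_
    simp only [AlgHom.coe_toContinuousLinearMap, map_smul]
    congr 1
    have hz : IsUnit (algebraMap ℂ B (circleMap 0 r θ) - x) := by
      by_contra h
      exact hx _ h (by simp [abs_of_pos hr])
    refine eq_inv_of_mul_eq_one_left ?_
    have h1 := congrArg χ (Ring.inverse_mul_cancel _ hz)
    rw [map_mul, map_sub, AlgHomClass.commutes, map_one] at h1
    exact h1
  refine ⟨(2 * Real.pi * Complex.I : ℂ)⁻¹ • ∮ z in C(0, r), resolvent x z,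
    fun χ => ⟨fun h => ?_, fun h => ?_⟩⟩
  · exact (key χ).trans (by
      rw [circleIntegral.integral_sub_inv_of_mem_ball (mem_ball_zero_iff.2 h), smul_eq_mul]
      exact inv_mul_cancel₀ Complex.two_pi_I_ne_zero)
  · exact (key χ).trans (by
      rw [Complex.circleIntegral_sub_inv_of_radius_lt hr.le h, smul_zero])

theorem continuous_characterSpace_apply {A : Type*} [NonUnitalNormedRing A]
    [NormedSpace ℂ A] (x : A) :
    Continuous fun s : WeakDual.characterSpace ℂ A => s x :=
  (WeakDual.eval_continuous x).comp continuous_subtype_val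

/-! ### Relative units in regular semisimple algebras -/

section LocalUnits

variable {A : Type*} [NonUnitalNormedCommRing A] [NormedSpace ℂ A] [IsScalarTower ℂ A A]
  [SMulCommClass ℂ A A]

/-- The unitization of a commutative normed algebra is commutative. -/
noncomputable instance WithLp.instUnitizationNormedCommRing :
    NormedCommRing (WithLp 1 (Unitization ℂ A)) where
  __ := WithLp.instUnitizationNormedRing
  mul_comm x y := WithLp.ofLp_injective 1 (mul_comm (WithLp.ofLp x) (WithLp.ofLp y))

/-- The extension of a multiplicative functional to the unitization. -/
noncomputable def unitizationLift (φ : A →ₙₐ[ℂ] ℂ) : WithLp 1 (Unitization ℂ A) →ₐ[ℂ] ℂ :=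
  (Unitization.lift φ).comp (WithLp.unitizationAlgEquiv (𝕜 := ℂ) (A := A) ℂ).toAlgHom

theorem unitizationLift_apply (φ : A →ₙₐ[ℂ] ℂ) (u : WithLp 1 (Unitization ℂ A)) :
    unitizationLift φ u = u.ofLp.fst + φ u.ofLp.snd := by
  simp [unitizationLift]

/-- In a regular Banach algebra, a set where some Gelfand transform is bounded below carries a
relative unit. -/
theorem IsRegularBanachAlgebra.exists_eq_one [CompleteSpace A] (hA : IsRegularBanachAlgebra A)
    (x : A) {r : ℝ} (hr : 0 < r) :
    ∃ e : A, ∀ s : WeakDual.characterSpace ℂ A, r ≤ ‖s x‖ → s e = 1 := by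
  have hKc : IsClosed {s : WeakDual.characterSpace ℂ A | r ≤ ‖s x‖} :=
    isClosed_le continuous_const (continuous_characterSpace_apply x).norm
  -- The elements vanishing on K ∪ {∞}, where K = {r ≤ |x|} and ∞ is the character of the
  -- unitization that kills `A`. In the quotient the values of `x` are 0 or of modulus at least `r`,
  -- so the circle of radius r/2 separates ∞ from K.
  let L : Ideal (WithLp 1 (Unitization ℂ A)) :=
    RingHom.ker (unitizationLift (0 : A →ₙₐ[ℂ] ℂ)) ⊓
      ⨅ s : {s : WeakDual.characterSpace ℂ A | r ≤ ‖s x‖},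
        RingHom.ker (unitizationLift (WeakDual.CharacterSpace.toNonUnitalAlgHom s.1))
  have hker : ∀ χ : WithLp 1 (Unitization ℂ A) →ₐ[ℂ] ℂ,
      IsClosed (RingHom.ker χ : Set (WithLp 1 (Unitization ℂ A))) := fun χ =>
    isClosed_singleton.preimage (χ.toContinuousLinearMap.continuous)
  have hL : IsClosed (L : Set (WithLp 1 (Unitization ℂ A))) := by
    simp only [L, Submodule.coe_inf, Submodule.coe_iInf]
    exact (hker _).inter (isClosed_iInter fun s => hker _)
  let ι : A → WithLp 1 (Unitization ℂ A) ⧸ L :=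
    fun a => Ideal.Quotient.mk L (WithLp.toLp 1 (a : Unitization ℂ A))
  have hspec : ∀ z ∈ spectrum ℂ (ι x), ‖z‖ ≠ r / 2 := by
    intro z hz
    obtain ⟨χ, rfl⟩ := WeakDual.CharacterSpace.mem_spectrum_iff_exists.1 hz
    by_cases h0 : χ (ι x) = 0
    · rw [h0, norm_zero]
      positivity
    have hcont : Continuous fun a : A => χ (ι a) :=
      (map_continuous χ).comp (continuous_quot_mk.comp
        WithLp.unitization_isometry_inr.continuous)
    let t : WeakDual.characterSpace ℂ A :=
      ⟨⟨⟨⟨fun a => χ (ι a), fun a b => by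
          rw [← map_add]
          exact congrArg (fun u => χ (Ideal.Quotient.mk L (WithLp.toLp 1 u)))
            (Unitization.inr_add ℂ a b)⟩, fun c a => by
          rw [RingHom.id_apply, ← map_smul]
          exact congrArg (fun u => χ (Ideal.Quotient.mk L (WithLp.toLp 1 u)))
            (Unitization.inr_smul ℂ c a)⟩, hcont⟩,
        fun h => h0 (congrArg (fun f : WeakDual ℂ A => f x) h), fun a b => by
          change χ (ι (a * b)) = χ (ι a) * χ (ι b)
          rw [← map_mul]
          exact congrArg (fun u => χ (Ideal.Quotient.mk L (WithLp.toLp 1 u)))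
            (Unitization.inr_mul ℂ a b)⟩
    have ht : ∀ a, t a = χ (ι a) := fun a => rfl
    have htK : t ∈ {s : WeakDual.characterSpace ℂ A | r ≤ ‖s x‖} := by
      by_contra hn
      -- Otherwise regularity gives an `a` in `L` with `t a = 1`, although `t` factors through the
      -- quotient by `L`.
      obtain ⟨a, ha, hK⟩ := hA _ hKc t hn
      have : ι a = 0 := by
        refine Ideal.Quotient.eq_zero_iff_mem.2 ?_
        simp only [L, Submodule.mem_inf, Submodule.mem_iInf, RingHom.mem_ker,
          unitizationLift_apply]
        exact ⟨by simp, fun s => by simpa using hK s.1 s.2⟩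
      rw [ht, this, map_zero] at ha
      exact zero_ne_one ha
    have : r ≤ ‖χ (ι x)‖ := htK
    linarith
  obtain ⟨p, hp⟩ := exists_riesz_projection (ι x) (half_pos hr) hspec
  obtain ⟨u, rfl⟩ := Ideal.Quotient.mk_surjective p
  have h0 := (hp (Ideal.Quotient.liftₐ L (unitizationLift 0) fun a ha => ha.1)).1 (by
    change ‖unitizationLift 0 (WithLp.toLp 1 (x : Unitization ℂ A))‖ < r / 2
    rw [unitizationLift_apply]
    simpa using hr)
  change unitizationLift 0 u = 1 at h0
  rw [unitizationLift_apply] at h0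
  -- The lift `u` of the projection is 1 at ∞ and 0 on K, so 1 − u lies in `A` and equals 1 on K.
  refine ⟨-u.ofLp.snd, fun s hs => ?_⟩
  have h1 := (hp (Ideal.Quotient.liftₐ L
    (unitizationLift (WeakDual.CharacterSpace.toNonUnitalAlgHom s)) fun a ha => by
      have := (Submodule.mem_iInf _).1 ha.2 ⟨s, hs⟩
      exact this)).2 (by
    change r / 2 < ‖unitizationLift _ (WithLp.toLp 1 (x : Unitization ℂ A))‖
    rw [unitizationLift_apply]
    simpa using (half_lt_self hr).trans_le hs)
  change unitizationLift _ u = 0 at h1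
  rw [unitizationLift_apply] at h1
  simp only [NonUnitalAlgHom.zero_apply, add_zero] at h0
  rw [h0, WeakDual.CharacterSpace.coe_toNonUnitalAlgHom] at h1
  rw [map_neg]
  linear_combination -h1

/-- The elements of a commutative algebra that have a relative unit. -/
def locallyUnital (A : Type*) [NonUnitalNormedCommRing A] [NormedSpace ℂ A] [IsScalarTower ℂ A A]
    [SMulCommClass ℂ A A] : Submodule ℂ A where
  carrier := {a | ∃ e, e * a = a}
  zero_mem' := ⟨0, mul_zero 0⟩
  add_mem' := by
    rintro a b ⟨e, he⟩ ⟨f, hf⟩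
    -- This is 1 − (1 − f)(1 − e), a unit for both `a` and `b`.
    refine ⟨e + f - f * e, ?_⟩
    have h1 : (e + f - f * e) * a = a := by
      rw [sub_mul, add_mul, mul_assoc, he, add_sub_cancel_right]
    have h2 : (e + f - f * e) * b = b := by
      rw [sub_mul, add_mul, mul_comm f e, mul_assoc, hf, add_sub_cancel_left]
    rw [mul_add, h1, h2]
  smul_mem' := by
    rintro c a ⟨e, he⟩
    exact ⟨e, by rw [mul_smul_comm, he]⟩

theorem mul_mem_locallyUnital (b : A) {a : A} (ha : a ∈ locallyUnital A) :
    b * a ∈ locallyUnital A := by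
  obtain ⟨e, he⟩ := ha
  exact ⟨e, by rw [mul_left_comm, he]⟩

/-- Given `t`, choose `x` with x(t) = 1, then `e` equal to 1 where |x| ≥ 1/2 and `a` with a(t) = 1
vanishing where |x| ≤ 1/2. Semisimplicity gives ea = a, and `a` does not vanish at `t`. -/
theorem hull_locallyUnital [CompleteSpace A] (hs : IsSemisimpleBanachAlgebra A)
    (hr : IsRegularBanachAlgebra A) : hull (locallyUnital A : Set A) = ∅ := by
  refine Set.eq_empty_of_forall_notMem fun t ht => ?_
  obtain ⟨x, hx, -⟩ := hr ∅ isClosed_empty t (Set.notMem_empty t)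
  obtain ⟨e, he⟩ := hr.exists_eq_one x (r := 1 / 2) (by norm_num)
  obtain ⟨a, ha, ha'⟩ := hr {s | ‖s x‖ ≤ 1 / 2}
    (isClosed_le (continuous_characterSpace_apply x).norm continuous_const) t (by
      simp only [Set.mem_ofPred_eq, hx]
      norm_num)
  refine one_ne_zero (ha.symm.trans (ht a ⟨e, ?_⟩))
  rw [← sub_eq_zero]
  refine hs _ fun s => ?_
  rw [map_sub, map_mul]
  rcases le_total (1 / 2) ‖s x‖ with h | h
  · rw [he s h, one_mul, sub_self]
  · rw [ha' s h, mul_zero, sub_self]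

end LocalUnits

/-! ### Consequences of the hyper-Tauberian property -/

section HyperTauberian

variable {A : Type*} [NonUnitalNormedCommRing A] [NormedSpace ℂ A] [IsScalarTower ℂ A A]
  [SMulCommClass ℂ A A]

theorem BanachLeftModule.dual_act_apply (a b : A) (f : StrongDual ℂ A) :
    (BanachLeftModule.dual A).act a f b = f (b * a) := rfl

/-- Elements with a relative unit are dense in a hyper-Tauberian algebra. -/
theorem IsHyperTauberian.dense_locallyUnital [CompleteSpace A] (hA : IsHyperTauberian A) :
    Dense (locallyUnital A : Set A) := by
  have hull_eq := hull_locallyUnital hA.semisimple hA.regular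
  have main : ∀ f : StrongDual ℂ A, (∀ a ∈ locallyUnital A, f a = 0) → f = 0 := by
    intro f hf
    by_contra hf0
    have hmul : ∀ g : StrongDual ℂ A, ∀ a b : A,
        g (a * b) • f = g b • (BanachLeftModule.dual A).act a f := by
      intro g a b
      -- The rank-one operator x ↦ g(x)f is local because its values have empty support: every
      -- locally unital element annihilates `f`, and these elements have empty hull.
      have := hA.multiplier (g.smulRight f) (fun x t ht => ?_) a b
      · simpa using this
      · refine (Set.eq_empty_iff_forall_notMem.1 hull_eq t fun c hc => ht c ?_).elim
        change (BanachLeftModule.dual A).act c (g x • f) = 0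
        ext d
        rw [map_smul, smul_apply, BanachLeftModule.dual_act_apply,
          hf _ (mul_mem_locallyUnital d hc)]
        simp
    -- For `a` with relative unit `e`, a · f = 0 turns `hmul` into g(ae)f = 0 for every `g`, so a =
    -- ae = 0. The empty hull then leaves no characters, and semisimplicity forces A = 0.
    have hJ : ∀ a ∈ locallyUnital A, a = 0 := by
      rintro a ⟨e, he⟩
      rw [← he, mul_comm]
      refine SeparatingDual.eq_zero_of_forall_dual_eq_zero (R := ℂ) fun g => ?_
      obtain ⟨d, hd⟩ : ∃ d, f d ≠ 0 := by
        by_contra! hd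
        exact hf0 (ContinuousLinearMap.ext hd)
      have h : g (a * e) * f d = g e * f (d * a) :=
        congrArg (fun k : StrongDual ℂ A => k d) (hmul g a e)
      rw [hf _ (mul_mem_locallyUnital d ⟨e, he⟩), mul_zero] at h
      exact (mul_eq_zero.1 h).resolve_right hd
    refine hf0 (ContinuousLinearMap.ext fun a => ?_)
    have : a = 0 := hA.semisimple a fun t =>
      (Set.eq_empty_iff_forall_notMem.1 hull_eq t fun c hc => by rw [hJ c hc, map_zero]).elim
    rw [this, map_zero, map_zero]
  intro x
  by_contra hx
  have : IsClosed ((locallyUnital A).topologicalClosure : Set A) :=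
    (locallyUnital A).isClosed_topologicalClosure
  obtain ⟨f, hf⟩ := SeparatingDual.exists_ne_zero (R := ℂ)
    (mt (Submodule.Quotient.mk_eq_zero (locallyUnital A).topologicalClosure).1 hx)
  have h0 := main (f.comp (locallyUnital A).topologicalClosure.mkQL) fun a ha => by
    have := (Submodule.Quotient.mk_eq_zero (locallyUnital A).topologicalClosure).2
      ((locallyUnital A).le_topologicalClosure ha)
    change f (Submodule.Quotient.mk a) = 0
    rw [this, map_zero]
  exact hf (congrArg (fun g : StrongDual ℂ A => g x) h0)

/-- Bounded bilinear maps on a hyper-Tauberian algebra that vanish at zero products are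
balanced. -/
theorem IsHyperTauberian.balanced_of_zero_product (hA : IsHyperTauberian A) {X : Type*}
    [NormedAddCommGroup X] [NormedSpace ℂ X] (ψ : A →L[ℂ] A →L[ℂ] X)
    (hψ : ∀ a b, a * b = 0 → ψ a b = 0) (a b c : A) : ψ (a * b) c = ψ b (a * c) := by
  refine (SeparatingDual.eq_iff_forall_dual_eq (R := ℂ)).2 fun f => ?_
  -- The operator x ↦ f(ψ(x, ·)) is local: if dx = 0 then x(ed) = 0 for all `e`, so `d` also
  -- annihilates the image of `x`.
  have := hA.multiplier ((ContinuousLinearMap.compL ℂ A X ℂ f).comp ψ) (fun x t ht d hd => ?_) a b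
  · have h := congrArg (fun g : StrongDual ℂ A => g c) this
    simp only [BanachLeftModule.dual_act_apply] at h
    rw [mul_comm a c]
    exact h
  · refine ht d ?_
    change (BanachLeftModule.dual A).act d _ = 0
    ext e
    rw [BanachLeftModule.dual_act_apply]
    have hx : ψ x (e * d) = 0 := by
      refine hψ _ _ ?_
      have hd' : d * x = 0 := hd
      rw [mul_comm, mul_assoc, hd', mul_zero]
    change f (ψ x (e * d)) = 0
    rw [hx, map_zero]

/-- A bounded bilinear map on a unital algebra containing a hyper-Tauberian algebra `A` that
vanishes at zero products is balanced at the elements of `A` with a relative unit. -/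
theorem IsHyperTauberian.apply_one_eq_one_apply (hA : IsHyperTauberian A) {B X : Type*}
    [NormedRing B] [NormedAlgebra ℂ B] [NormedAddCommGroup X] [NormedSpace ℂ X]
    (ι : A →L[ℂ] B) (hι : ∀ a b, ι (a * b) = ι a * ι b) (φ : B →L[ℂ] B →L[ℂ] X)
    (hφ : ∀ a b, a * b = 0 → φ a b = 0) {a : A} (ha : a ∈ locallyUnital A) :
    φ (ι a) 1 = φ 1 (ι a) := by
  obtain ⟨e, he⟩ := ha
  -- Both products of `a` with 1 − e vanish, so each 1 can be replaced by `e`; balancedness on `A`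
  -- then compares φ(ae, e) with φ(e, ae).
  have h1 : φ (ι a) (1 - ι e) = 0 := hφ _ _ (by
    rw [mul_sub, mul_one, ← hι, mul_comm a, he, sub_self])
  have h2 : φ (1 - ι e) (ι a) = 0 := hφ _ _ (by rw [sub_mul, one_mul, ← hι, he, sub_self])
  rw [map_sub, sub_eq_zero] at h1
  rw [map_sub, sub_apply, sub_eq_zero] at h2
  rw [h1, h2]
  have := hA.balanced_of_zero_product (φ.bilinearComp ι ι)
    (fun x y hxy => hφ _ _ ((hι x y).symm.trans (by rw [hxy, map_zero]))) a e e
  simpa [mul_comm a e, he] using this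

end HyperTauberian

/-! ### Alternating sums and contracted tuples -/

theorem Fin.sum_alternating_add {X : Type*} [AddCommGroup X] [Module ℂ X] {n : ℕ}
    (u : Fin (n + 1) → X) :
    ∑ j : Fin n, (-1 : ℂ) ^ ((j : ℕ) + 1) • (u j.castSucc + u j.succ)
      = (-1 : ℂ) ^ n • u (Fin.last n) - u 0 := by
  induction n with
  | zero => simp
  | succ n ih =>
    rw [Fin.sum_univ_castSucc]
    have := ih (fun i => u i.castSucc)
    simp only [← Fin.succ_castSucc, Fin.castSucc_zero] at this
    simp only [Fin.val_castSucc, this, Fin.val_last, Fin.succ_last]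
    rw [pow_succ]
    module

theorem Fin.contractNth_castSucc_eq_update {α : Type*} {n : ℕ} (op : α → α → α)
    (a : Fin (n + 1) → α) (j : Fin n) :
    Fin.contractNth j.castSucc op a =
      Function.update (fun k => a (j.castSucc.succAbove k)) j (op (a j.castSucc) (a j.succ)) := by
  funext k
  rcases eq_or_ne k j with rfl | h
  · rw [Function.update_self, Fin.contractNth_apply_of_eq _ _ _ _ rfl]
  · rw [Function.update_of_ne h, Fin.contractNth_apply_of_ne]
    intro h'
    exact h (Fin.ext h'.symm)

theorem Fin.comp_succAbove_succ_eq_update {α : Type*} {n : ℕ} (a : Fin (n + 1) → α) (j : Fin n) :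
    (fun k => a (j.succ.succAbove k)) =
      Function.update (fun k => a (j.castSucc.succAbove k)) j (a j.castSucc) := by
  funext k
  rcases eq_or_ne k j with rfl | h
  · simp
  · rw [Function.update_of_ne h]
    congr 1
    rcases lt_or_gt_of_ne h with h | h
    · rw [Fin.succAbove_of_castSucc_lt, Fin.succAbove_of_castSucc_lt] <;>
        simp only [Fin.lt_def, Fin.val_castSucc, Fin.val_succ] at * <;> omega
    · rw [Fin.succAbove_of_le_castSucc, Fin.succAbove_of_le_castSucc] <;>
        simp only [Fin.lt_def, Fin.le_def, Fin.val_castSucc, Fin.val_succ] at * <;> omega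

/-! ### Normalized extension of cocycles to the unitization -/

section Unitization

variable {A X : Type*} [NonUnitalNormedRing A] [NormedSpace ℂ A]
  [NormedAddCommGroup X] [NormedSpace ℂ X]

/-- The `A`-part of (λ + a)(μ + c) is ac + λc + μa. Each scalar term pulls its scalar out of slot
`j` and deletes the corresponding entry of `b`. -/
theorem MultilinearMap.apply_contractNth_snd {n : ℕ}
    (S : MultilinearMap ℂ (fun _ : Fin n => A) X) (b : Fin (n + 1) → Unitization ℂ A) (j : Fin n) :
    S (fun k => (Fin.contractNth j.castSucc (· * ·) b k).snd) =
      S (Fin.contractNth j.castSucc (· * ·) fun i => (b i).snd)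
        + ((b j.castSucc).fst • S (fun k => (b (j.castSucc.succAbove k)).snd)
        + (b j.succ).fst • S (fun k => (b (j.succ.succAbove k)).snd)) := by
  have h1 := Fin.contractNth_castSucc_eq_update (· * ·) (fun i => (b i).snd) j
  have h2 := Fin.comp_succAbove_succ_eq_update (fun i => (b i).snd) j
  have h3 : (fun k => (b (j.castSucc.succAbove k)).snd) =
      Function.update (fun k => (b (j.castSucc.succAbove k)).snd) j (b j.succ).snd := by
    rw [eq_comm, Function.update_eq_self_iff, Fin.succAbove_castSucc_self]
  have h4 : (fun k => (Fin.contractNth j.castSucc (· * ·) b k).snd) =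
      Function.update (fun k => (b (j.castSucc.succAbove k)).snd) j
        (b j.castSucc * b j.succ).snd := by
    rw [Fin.contractNth_castSucc_eq_update]
    funext k
    rcases eq_or_ne k j with rfl | h
    · simp only [Function.update_self]
    · simp only [Function.update_of_ne h]
  rw [h1, h2, h4]
  nth_rw 3 [h3]
  simp only [← MultilinearMap.map_update_smul, ← MultilinearMap.map_update_add,
    Unitization.snd_mul]
  congr 2
  abel

/-- The normalized extension of an `n`-cocycle on `A` is an `n`-cocycle on the unitization. -/
theorem IsCocycle.unitization {M : BanachBimodule A X} {n : ℕ}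
    {S : MultilinearMap ℂ (fun _ : Fin n => A) X} (hS : IsCocycle M S)
    (b : Fin (n + 1) → Unitization ℂ A) :
    (b 0).fst • S (fun i => (b i.succ).snd) + M.left (b 0).snd (S fun i => (b i.succ).snd)
      + ∑ j : Fin n, (-1 : ℂ) ^ ((j : ℕ) + 1) •
          S (fun k => (Fin.contractNth j.castSucc (· * ·) b k).snd)
      + (-1 : ℂ) ^ (n + 1) • ((b (Fin.last n)).fst • S (fun i => (b i.castSucc).snd)
          + M.right (b (Fin.last n)).snd (S fun i => (b i.castSucc).snd)) = 0 := by
  have h := hS fun i => (b i).snd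
  -- The scalar contributions of the inner terms telescope; the two survivors cancel the scalar
  -- parts of the outer terms.
  have htel := Fin.sum_alternating_add fun i => (b i).fst • S (fun k => (b (i.succAbove k)).snd)
  unfold coboundary at h
  simp only [MultilinearMap.apply_contractNth_snd, smul_add _ (S _) (_ + _),
    Finset.sum_add_distrib, htel, Fin.succAbove_last, Fin.succAbove_zero]
  rw [← h]
  simp only [pow_succ]
  module

end Unitization

/-! ### Hyperlocal maps and the inductive cocycle identity -/

section Hyperlocal

variable {B X : Type*} [NormedRing B] [NormedAlgebra ℂ B] [NormedAddCommGroup X] [NormedSpace ℂ X]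

/-- A multilinear map in `n + 2` variables, the last one curried, is hyperlocal when it vanishes
at all tuples whose consecutive products are zero. -/
def ContinuousMultilinearMap.IsHyperlocal {n : ℕ}
    (G : ContinuousMultilinearMap ℂ (fun _ : Fin (n + 1) => B) (B →L[ℂ] X)) : Prop :=
  ∀ (b : Fin (n + 1) → B) (v : B), (∀ i : Fin n, b i.castSucc * b i.succ = 0) →
    b (Fin.last n) * v = 0 → G b v = 0

/-- The difference between freezing the first variable of `G` at `w` and moving `w` into the second
variable. -/
noncomputable def ContinuousMultilinearMap.shift {n : ℕ}
    (G : ContinuousMultilinearMap ℂ (fun _ : Fin (n + 2) => B) (B →L[ℂ] X)) (w : B) :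
    ContinuousMultilinearMap ℂ (fun _ : Fin (n + 1) => B) (B →L[ℂ] X) :=
  G.curryLeft w - (G.curryLeft 1).compContinuousLinearMap
    (fun i => if i = 0 then ContinuousLinearMap.mul ℂ B w else ContinuousLinearMap.id ℂ B)

theorem ContinuousMultilinearMap.shift_apply_cons {n : ℕ}
    (G : ContinuousMultilinearMap ℂ (fun _ : Fin (n + 2) => B) (B →L[ℂ] X)) (w x : B)
    (b : Fin n → B) :
    G.shift w (Fin.cons x b) =
      G (Fin.cons w (Fin.cons x b)) - G (Fin.cons 1 (Fin.cons (w * x) b)) := by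
  have : (fun i : Fin (n + 1) => (if i = 0 then ContinuousLinearMap.mul ℂ B w
      else ContinuousLinearMap.id ℂ B) ((Fin.cons x b : Fin (n + 1) → B) i)) =
      (Fin.cons (w * x) b : Fin (n + 1) → B) := by
    funext i
    refine Fin.cases ?_ (fun i => ?_) i
    · simp
    · simp [Fin.succ_ne_zero]
  change G (Fin.cons w (Fin.cons x b)) - G (Fin.cons 1 (fun i : Fin (n + 1) =>
    (if i = 0 then ContinuousLinearMap.mul ℂ B w
      else ContinuousLinearMap.id ℂ B) ((Fin.cons x b : Fin (n + 1) → B) i))) = _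
  rw [this]

theorem Fin.contractNth_succ_cons {α : Type*} {n : ℕ} (op : α → α → α) (x : α)
    (a : Fin (n + 1) → α) (j : Fin n) :
    Fin.contractNth j.succ.castSucc op (Fin.cons x a : Fin (n + 2) → α) =
      Fin.cons x (Fin.contractNth j.castSucc op a) := by
  funext k
  refine Fin.cases ?_ (fun k => ?_) k
  · simp [Fin.contractNth]
  · simp [Fin.contractNth]

theorem Fin.contractNth_zero_cons_cons {α : Type*} {n : ℕ} (op : α → α → α) (x y : α)
    (a : Fin n → α) :
    Fin.contractNth (0 : Fin (n + 1)).castSucc op (Fin.cons x (Fin.cons y a) : Fin (n + 2) → α) =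
      Fin.cons (op x y) a := by
  funext k
  refine Fin.cases ?_ (fun k => ?_) k
  · simp [Fin.contractNth]
  · simp [Fin.contractNth]

variable {A : Type*} [NonUnitalNormedCommRing A] [NormedSpace ℂ A] [IsScalarTower ℂ A A]
  [SMulCommClass ℂ A A]

/-- With the later variables frozen, φ(p, q) = G(p, qy, …) vanishes when pq = 0, since left
multiplication of `y` by `q` preserves the zero product with its right neighbour. Hence φ(ιa, 1) =
φ(1, ιa), which is the vanishing of the shift. -/
theorem ContinuousMultilinearMap.IsHyperlocal.shift (hA : IsHyperTauberian A)
    {ι : A →L[ℂ] B} (hι : ∀ a b, ι (a * b) = ι a * ι b) {n : ℕ}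
    {G : ContinuousMultilinearMap ℂ (fun _ : Fin (n + 2) => B) (B →L[ℂ] X)} (hG : G.IsHyperlocal)
    {a : A} (ha : a ∈ locallyUnital A) : (G.shift (ι a)).IsHyperlocal := by
  intro b v hb hv
  obtain ⟨y, b, rfl⟩ : ∃ (y : B) (b' : Fin n → B), b = Fin.cons y b' :=
    ⟨b 0, Fin.tail b, (Fin.cons_self_tail b).symm⟩
  let φ : B →L[ℂ] B →L[ℂ] X :=
    ((ContinuousLinearMap.compL ℂ B (ContinuousMultilinearMap ℂ (fun _ : Fin n => B) (B →L[ℂ] X)) X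
      ((ContinuousLinearMap.apply ℂ X v).comp
        (ContinuousMultilinearMap.apply ℂ (fun _ : Fin n => B) (B →L[ℂ] X) b))).comp
      (((continuousMultilinearCurryLeftEquiv ℂ (fun _ : Fin (n + 1) => B)
        (B →L[ℂ] X)).toContinuousLinearEquiv : _ →L[ℂ] _).comp G.curryLeft)).bilinearComp
      (ContinuousLinearMap.id ℂ B) ((ContinuousLinearMap.mul ℂ B).flip y)
  have hφ : ∀ p q, φ p q = G (Fin.cons p (Fin.cons (q * y) b)) v := fun p q => rfl
  have key := hA.apply_one_eq_one_apply ι hι φ (fun p q hpq => ?_) ha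
  · rw [hφ, hφ, one_mul] at key
    rw [G.shift_apply_cons, sub_apply, key, sub_self]
  · rw [hφ]
    refine hG _ _ (fun i => ?_) ?_
    · refine Fin.cases ?_ (fun i => ?_) i
      · simp [← mul_assoc, hpq]
      · rw [← Fin.succ_castSucc, Fin.cons_succ, Fin.cons_succ]
        have h := hb
        cases n with
        | zero => exact i.elim0
        | succ n =>
          have h := hb i
          revert h
          refine Fin.cases ?_ (fun i => ?_) i
          · intro h
            simp only [Fin.castSucc_zero, Fin.cons_zero, Fin.cons_succ] at h ⊢
            rw [mul_assoc, h, mul_zero]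
          · intro h
            simpa only [← Fin.succ_castSucc, Fin.cons_succ] using h
    · cases n with
      | zero =>
        have hv' : y * v = 0 := hv
        change q * y * v = 0
        rw [mul_assoc, hv', mul_zero]
      | succ n =>
        rw [← Fin.succ_last, Fin.cons_succ, ← Fin.succ_last, Fin.cons_succ]
        rwa [← Fin.succ_last, Fin.cons_succ] at hv

/-- Hyperlocal maps that vanish when an inner variable is the unit satisfy the cocycle identity
at elements with a relative unit. -/
theorem ContinuousMultilinearMap.IsHyperlocal.cocycle_identity (hA : IsHyperTauberian A)
    {ι : A →L[ℂ] B} (hι : ∀ a b, ι (a * b) = ι a * ι b) {n : ℕ}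
    {G : ContinuousMultilinearMap ℂ (fun _ : Fin (n + 1) => B) (B →L[ℂ] X)} (hG : G.IsHyperlocal)
    (hG1 : ∀ (b : Fin (n + 1) → B) (i : Fin n), b i.succ = 1 → G b = 0)
    {a : Fin (n + 1) → A} (ha : ∀ i, a i ∈ locallyUnital A) (v : B) :
    G (fun i => ι (a i)) v
      + ∑ i : Fin n, (-1 : ℂ) ^ ((i : ℕ) + 1) •
          G (Fin.cons 1 (Fin.contractNth i.castSucc (· * ·) fun i => ι (a i))) v
      + (-1 : ℂ) ^ (n + 1) •
          G (Fin.cons 1 fun i : Fin n => ι (a i.castSucc)) (ι (a (Fin.last n)) * v) = 0 := by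
  induction n with
  | zero =>
    let φ : B →L[ℂ] B →L[ℂ] X := (G.toContinuousLinearMap (fun _ => 0) 0).bilinearComp
      (ContinuousLinearMap.id ℂ B) ((ContinuousLinearMap.mul ℂ B).flip v)
    have hφ : ∀ p q, φ p q = G (fun _ => p) (q * v) := fun p q => by
      change G (Function.update (fun _ => 0) 0 p) (q * v) = _
      congr 2
      funext i
      rw [Fin.fin_one_eq_zero i, Function.update_self]
    have key := hA.apply_one_eq_one_apply ι hι φ (fun p q hpq => by
      rw [hφ]
      exact hG _ _ (fun i => i.elim0) (by rw [← mul_assoc, hpq, zero_mul])) (ha 0)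
    rw [hφ, hφ, one_mul] at key
    have h1 : (fun i => ι (a i)) = fun _ : Fin 1 => ι (a 0) :=
      funext fun i => by rw [Fin.fin_one_eq_zero i]
    have h2 : (Fin.cons 1 fun i : Fin 0 => ι (a i.castSucc)) = fun _ : Fin 1 => (1 : B) :=
      funext fun i => by rw [Fin.fin_one_eq_zero i]; rfl
    rw [h1, h2, key]
    simp
  | succ n ih =>
    obtain ⟨x, y, a, rfl⟩ : ∃ (x y : A) (a' : Fin n → A), a = Fin.cons x (Fin.cons y a') :=
      ⟨a 0, a 1, Fin.tail (Fin.tail a), by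
        funext i
        refine Fin.cases rfl (fun i => ?_) i
        refine Fin.cases rfl (fun i => rfl) i⟩
    have hx : x ∈ locallyUnital A := ha 0
    have h1 : ∀ b : Fin n → B, ∀ p q, G (Fin.cons p (Fin.cons 1 b)) q = 0 := fun b p q => by
      rw [hG1 _ 0 rfl]
      rfl
    -- Each term of the identity for the shift splits in two. The first yields the leading term and
    -- the contraction `x * y`; in the others G(x, 1, …) vanishes by normalization, and the
    -- remaining −G(1, x, …) supplies the sign change for the moved index.
    have := ih (hG.shift hA hι hx) (fun b i hb => by
      rw [← Fin.cons_self_tail b, G.shift_apply_cons, hG1 _ i.succ, hG1 _ i.succ, sub_zero]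
      · rw [Fin.cons_succ, Fin.cons_succ]; exact hb
      · rw [Fin.cons_succ, Fin.cons_succ]; exact hb) (a := Fin.cons y a) (fun i => ha i.succ)
    have e1 : ∀ (m : ℕ) (z : A) (c : Fin m → A), (fun i => ι ((Fin.cons z c : Fin (m + 1) → A) i)) =
        (Fin.cons (ι z) (fun i => ι (c i)) : Fin (m + 1) → B) := fun m z c => by
      funext i
      exact Fin.cases rfl (fun i => rfl) i
    have e2 : (fun i : Fin (n + 1) => ι ((Fin.cons x (Fin.cons y a) : Fin (n + 2) → A) i.castSucc))
        = Fin.cons (ι x) (fun i : Fin n => ι ((Fin.cons y a : Fin (n + 1) → A) i.castSucc)) := by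
      funext i
      exact Fin.cases rfl (fun i => rfl) i
    have e3 : (Fin.cons x (Fin.cons y a) : Fin (n + 2) → A) (Fin.last (n + 1)) =
        (Fin.cons y a : Fin (n + 1) → A) (Fin.last n) := rfl
    rw [e2, e3, Fin.sum_univ_succ]
    simp only [e1, G.shift_apply_cons, sub_apply, h1, mul_one, zero_sub] at this ⊢
    simp only [Fin.contractNth_succ_cons, Fin.contractNth_zero_cons_cons, Fin.val_succ]
    rw [← this]
    simp only [pow_succ _ (_ + 1), Fin.val_zero, zero_add, pow_one, mul_neg, mul_one, neg_smul,
      smul_neg, Finset.sum_neg_distrib]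
    module

end Hyperlocal

/-! ### The sandwich map of a local cocycle -/

/-- The map `(b₀, …, bₙ, v) ↦ L b₀ (R v (T (p b₁, …, p bₙ)))`, with the variable `v` curried. -/
noncomputable def ContinuousMultilinearMap.sandwich {A B X : Type*} [NormedAddCommGroup A]
    [NormedSpace ℂ A] [NormedAddCommGroup B] [NormedSpace ℂ B] [NormedAddCommGroup X]
    [NormedSpace ℂ X] {n : ℕ} (T : ContinuousMultilinearMap ℂ (fun _ : Fin n => A) X)
    (L R : B →L[ℂ] X →L[ℂ] X) (p : B →L[ℂ] A) :
    ContinuousMultilinearMap ℂ (fun _ : Fin (n + 1) => B) (B →L[ℂ] X) where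
  toFun b := (L (b 0)).comp (R.flip (T fun i => p (b i.succ)))
  map_update_add' := by
    intro inst b i x y
    obtain rfl : inst = instDecidableEqFin (n + 1) := Subsingleton.elim _ _
    refine Fin.cases ?_ (fun i => ?_) i
    · simp [Fin.succ_ne_zero, ContinuousLinearMap.add_comp]
    · have h : ∀ z, (fun k : Fin n => p (Function.update b i.succ z k.succ)) =
          Function.update (fun k => p (b k.succ)) i (p z) := fun z => by
        funext k
        rcases eq_or_ne k i with rfl | hk
        · simp
        · simp [hk]
      simp only [h, map_add, ContinuousMultilinearMap.map_update_add,
        Function.update_of_ne (Fin.succ_ne_zero i).symm, ContinuousLinearMap.comp_add]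
  map_update_smul' := by
    intro inst b i c x
    obtain rfl : inst = instDecidableEqFin (n + 1) := Subsingleton.elim _ _
    refine Fin.cases ?_ (fun i => ?_) i
    · simp [Fin.succ_ne_zero, ContinuousLinearMap.smul_comp]
    · have h : ∀ z, (fun k : Fin n => p (Function.update b i.succ z k.succ)) =
          Function.update (fun k => p (b k.succ)) i (p z) := fun z => by
        funext k
        rcases eq_or_ne k i with rfl | hk
        · simp
        · simp [hk]
      simp only [h, map_smul, ContinuousMultilinearMap.map_update_smul,
        Function.update_of_ne (Fin.succ_ne_zero i).symm, ContinuousLinearMap.comp_smul]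
  cont := by
    have hT : Continuous fun b : Fin (n + 1) → B => T fun i => p (b i.succ) :=
      T.cont.comp (by fun_prop)
    exact Continuous.clm_comp (by fun_prop) (R.flip.continuous.comp hT)

section Unitization

variable {A X : Type*} [NonUnitalNormedCommRing A] [NormedSpace ℂ A] [IsScalarTower ℂ A A]
  [SMulCommClass ℂ A A] [NormedAddCommGroup X] [NormedSpace ℂ X]

variable (A) in
/-- The inclusion of a normed algebra into its unitization. -/
noncomputable def unitizationInrCLM : A →L[ℂ] WithLp 1 (Unitization ℂ A) :=
  LinearMap.mkContinuous
    { toFun a := WithLp.toLp 1 (a : Unitization ℂ A)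
      map_add' a b := congrArg (WithLp.toLp 1) (Unitization.inr_add ℂ a b)
      map_smul' c a := congrArg (WithLp.toLp 1) (Unitization.inr_smul ℂ c a) } 1
    fun a => by rw [one_mul]; exact (WithLp.unitization_norm_inr a).le

theorem unitizationInrCLM_mul (a b : A) :
    unitizationInrCLM A (a * b) = unitizationInrCLM A a * unitizationInrCLM A b :=
  congrArg (WithLp.toLp 1) (Unitization.inr_mul ℂ a b)

variable (A) in
/-- The projection of the unitization onto the scalars. -/
noncomputable def unitizationFstCLM : WithLp 1 (Unitization ℂ A) →L[ℂ] ℂ :=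
  LinearMap.mkContinuous
    { toFun u := u.ofLp.fst
      map_add' _ _ := rfl
      map_smul' _ _ := rfl } 1
    fun u => by
      rw [one_mul, WithLp.unitization_norm_def]
      exact le_add_of_nonneg_right (norm_nonneg _)

variable (A) in
/-- The projection of the unitization onto the algebra. -/
noncomputable def unitizationSndCLM : WithLp 1 (Unitization ℂ A) →L[ℂ] A :=
  LinearMap.mkContinuous
    { toFun u := u.ofLp.snd
      map_add' _ _ := rfl
      map_smul' _ _ := rfl } 1
    fun u => by
      rw [one_mul, WithLp.unitization_norm_def]
      exact le_add_of_nonneg_left (norm_nonneg _)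

/-- The unital extension of a bounded action to the unitization. -/
noncomputable def unitizationAct (ρ : A →L[ℂ] X →L[ℂ] X) :
    WithLp 1 (Unitization ℂ A) →L[ℂ] X →L[ℂ] X :=
  (unitizationFstCLM A).smulRight (ContinuousLinearMap.id ℂ X) + ρ.comp (unitizationSndCLM A)

theorem unitizationAct_apply (ρ : A →L[ℂ] X →L[ℂ] X) (u : WithLp 1 (Unitization ℂ A)) (x : X) :
    unitizationAct ρ u x = u.ofLp.fst • x + ρ u.ofLp.snd x := rfl

theorem unitizationAct_inr (ρ : A →L[ℂ] X →L[ℂ] X) (a : A) (x : X) :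
    unitizationAct ρ (unitizationInrCLM A a) x = ρ a x := by
  change (0 : ℂ) • x + ρ a x = ρ a x
  rw [zero_smul, zero_add]

theorem unitizationAct_one (ρ : A →L[ℂ] X →L[ℂ] X) (x : X) : unitizationAct ρ 1 x = x := by
  change (1 : ℂ) • x + ρ 0 x = x
  simp

theorem BanachBimodule.unitizationAct_right_mul (M : BanachBimodule A X)
    (u v : WithLp 1 (Unitization ℂ A)) (x : X) :
    unitizationAct M.right (u * v) x = unitizationAct M.right v (unitizationAct M.right u x) := by
  simp only [unitizationAct_apply, WithLp.unitization_mul, Unitization.fst_mul,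
    Unitization.snd_mul, map_add, map_smul, add_apply, smul_apply, M.right_mul]
  module

theorem BanachBimodule.unitizationAct_left_right (M : BanachBimodule A X)
    (u v : WithLp 1 (Unitization ℂ A)) (x : X) :
    unitizationAct M.left u (unitizationAct M.right v x) =
      unitizationAct M.right v (unitizationAct M.left u x) := by
  simp only [unitizationAct_apply, map_add, map_smul, M.left_right]
  module

/-- The map `(b₀, …, bₙ, v) ↦ b₀ · T(b₁, …, bₙ) · v` on the unitization, for the normalized
extension of `T`, with the variable `v` curried. -/
noncomputable def BanachBimodule.sandwich (M : BanachBimodule A X) {n : ℕ}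
    (T : ContinuousMultilinearMap ℂ (fun _ : Fin n => A) X) :
    ContinuousMultilinearMap ℂ (fun _ : Fin (n + 1) => WithLp 1 (Unitization ℂ A))
      (WithLp 1 (Unitization ℂ A) →L[ℂ] X) :=
  T.sandwich (unitizationAct M.left) (unitizationAct M.right) (unitizationSndCLM A)

theorem BanachBimodule.sandwich_apply (M : BanachBimodule A X) {n : ℕ}
    (T : ContinuousMultilinearMap ℂ (fun _ : Fin n => A) X)
    (b : Fin (n + 1) → WithLp 1 (Unitization ℂ A)) (v : WithLp 1 (Unitization ℂ A)) :
    M.sandwich T b v =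
      unitizationAct M.left (b 0) (unitizationAct M.right v (T fun i => (b i.succ).ofLp.snd)) :=
  rfl

/-- In the extended cocycle identity of `S` at (b₀, …, bₙ) every inner term has a zero argument,
leaving b₀ · S(b₁, …, bₙ) = ± S(b₀, …, bₙ₋₁) · bₙ. Acting by `v` on the right kills this because bₙv
= 0. Only the value of `T` at (b₁, …, bₙ) enters, so one cocycle `S` suffices. -/
theorem IsLocalCocycle.isHyperlocal_sandwich {M : BanachBimodule A X} {n : ℕ}
    {T : ContinuousMultilinearMap ℂ (fun _ : Fin n => A) X}
    (hT : IsLocalCocycle M T.toMultilinearMap) : (M.sandwich T).IsHyperlocal := by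
  intro b v hb hv
  obtain ⟨S, hS, hTS⟩ := hT fun i => (b i.succ).ofLp.snd
  have h := hS.unitization fun i => (b i).ofLp
  have hsum : ∀ j : Fin n, S (fun k =>
      (Fin.contractNth j.castSucc (· * ·) (fun i => (b i).ofLp) k).snd) = 0 := fun j => by
    refine S.map_coord_zero j ?_
    rw [Fin.contractNth_apply_of_eq _ _ _ _ rfl, ← WithLp.unitization_mul, hb]
    rfl
  simp only [hsum, smul_zero, Finset.sum_const_zero, add_zero] at h
  rw [← unitizationAct_apply, ← unitizationAct_apply] at h
  rw [M.sandwich_apply, M.unitizationAct_left_right]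
  have h' := congrArg (unitizationAct M.right v) h
  rw [map_add, map_smul, ← M.unitizationAct_right_mul, hv, map_zero, map_zero, zero_apply,
    smul_zero, add_zero] at h'
  rw [← h']
  exact congrArg (fun x => unitizationAct M.right v (unitizationAct M.left (b 0) x)) hTS

theorem BanachBimodule.sandwich_eq_zero_of_eq_one (M : BanachBimodule A X) {n : ℕ}
    (T : ContinuousMultilinearMap ℂ (fun _ : Fin n => A) X)
    (b : Fin (n + 1) → WithLp 1 (Unitization ℂ A)) (i : Fin n) (hi : b i.succ = 1) :
    M.sandwich T b = 0 := by
  ext v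
  have h : T (fun i => (b i.succ).ofLp.snd) = 0 := T.map_coord_zero i (by rw [hi]; rfl)
  rw [M.sandwich_apply, h, map_zero, map_zero]
  rfl

end Unitization

/-! ### Conclusion by density -/

theorem continuous_coboundary {A X : Type*} [NonUnitalNormedRing A] [NormedSpace ℂ A]
    [NormedAddCommGroup X] [NormedSpace ℂ X] (M : BanachBimodule A X) {n : ℕ}
    (T : ContinuousMultilinearMap ℂ (fun _ : Fin n => A) X) :
    Continuous (coboundary M T.toMultilinearMap) := by
  have h : ∀ j : Fin n, Continuous fun a : Fin (n + 1) → A =>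
      T (Fin.contractNth j.castSucc (· * ·) a) := fun j => by
    refine T.cont.comp (continuous_pi fun k => ?_)
    unfold Fin.contractNth
    split_ifs <;> fun_prop
  have h1 : Continuous fun a : Fin (n + 1) → A => T fun i => a i.succ :=
    T.cont.comp (by fun_prop)
  have h2 : Continuous fun a : Fin (n + 1) → A => T fun i => a i.castSucc :=
    T.cont.comp (by fun_prop)
  refine ((Continuous.clm_apply (by fun_prop) h1).add
    (continuous_finsetSum _ fun j _ => (h j).const_smul _)).add
    ((Continuous.clm_apply (by fun_prop) h2).const_smul _)

theorem theoremT {A X : Type*}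
    [NonUnitalNormedCommRing A] [NormedSpace ℂ A] [IsScalarTower ℂ A A] [SMulCommClass ℂ A A]
    [CompleteSpace A]
    [NormedAddCommGroup X] [NormedSpace ℂ X] [CompleteSpace X]
    (hA : IsHyperTauberian A) (M : BanachBimodule A X) (n : ℕ)
    (T : ContinuousMultilinearMap ℂ (fun _ : Fin n => A) X)
    (hT : IsLocalCocycle M T.toMultilinearMap) :
    IsCocycle M T.toMultilinearMap := by
  have hdense : Dense (Set.univ.pi fun _ : Fin (n + 1) => (locallyUnital A : Set A)) :=
    dense_pi _ fun _ _ => hA.dense_locallyUnital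
  refine congrFun ((continuous_coboundary M T).ext_on hdense continuous_const fun a ha => ?_)
  -- At v = 1 the sandwich identity is the coboundary of `T` itself.
  have h := hT.isHyperlocal_sandwich.cocycle_identity hA unitizationInrCLM_mul
    (M.sandwich_eq_zero_of_eq_one T) (fun i => ha i trivial) 1
  simp only [M.sandwich_apply, unitizationAct_inr, unitizationAct_one, mul_one, Fin.cons_zero,
    Fin.cons_succ] at h
  have hc : ∀ j : Fin n, (fun k => (Fin.contractNth j.castSucc (· * ·)
      (fun i => unitizationInrCLM A (a i)) k).ofLp.snd) =
      Fin.contractNth j.castSucc (· * ·) a := fun j => by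
    have := Fin.comp_contractNth (· * ·) (· * ·) (f := unitizationInrCLM A)
      unitizationInrCLM_mul j.castSucc a
    exact congrArg (fun (c : Fin n → WithLp 1 (Unitization ℂ A)) k => (c k).ofLp.snd) this.symm
  simp only [hc] at h
  exact h
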